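/- Let $r,n\ge 0$ be integers and let $[n]=C_1\,\dot\cup\,\cdots\,\dot\cup\,C_r$ be a block partition, i.e. a partition into nonempty sets such that every element of $C_i$ is smaller than every element of $C_j$ whenever $i<j$. Let $\chi:\binom{[n]}{r+1}\to\{-,+\}$ be an $(r+1)$-signotope: for every $(r+2)$-subset $A=\{a_1<\cdots<a_{r+2}\}\subseteq[n]$ the sign sequence $\chi(A\setminus\{a_1\}),\chi(A\setminus\{a_2\}),\dots,\chi(A\setminus\{a_{r+2}\})$ has at most one sign change. Let $G$ be the grid on $C_1\times\cdots\times C_r$, i.e. the graph in which two $r$-tuples are adjacent iff they differ in exactly one coordinate, and let $\mathcal O_\chi$ be the following orientation of $G$: if $v,v'$ differ exactly in coordinate $i$, with entries $c<c'$ there, then $v\to v'$ if $\chi(c_1,\dots,c_{i-1},c,c',c_{i+1},\dots,c_r)=+$, and $v'\to v$ otherwise. Theorem. If $G$ has dimension at most $3$, i.e. at most three of the blocks $C_i$ have more than one element, then $\mathcal O_\chi$ is admissible. That is, $\mathcal O_\chi$ is a unique sink orientation (every subgrid $S=S_1\times\cdots\times S_r$ with $\emptyset\ne S_i\subseteq C_i$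 contains exactly one sink, a vertex of $S$ whose incident edges in $S$ are all incoming), and every such subgrid $S$ contains exactly one source (a vertex of $S$ whose incident edges in $S$ are all outgoing) and $|S_1|+\cdots+|S_r|-r$ distinct directed paths inside $S$ from its source to its sink, no two of which share a vertex other than the source and the sink. -/

import Mathlib

namespace GridUSO

/-! ### Grids and grid orientations -/

section Grid

variable {ι : Type*} {V : ι → Type*}

/-- The vertices `u` and `v` of the grid `∏ i, V i` differ in coordinate `i` and in no other
coordinate, that is, `{u, v}` is an edge of dimension `i`. -/
def DifferOnlyAt (i : ι) (u v : ∀ i, V i) : Prop :=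
  u i ≠ v i ∧ ∀ j, j ≠ i → u j = v j

/-- The grid (rook's graph) on `∏ i, V i`: two vertices are adjacent if they differ in exactly
one coordinate. -/
def gridGraph (V : ι → Type*) : SimpleGraph (∀ i, V i) where
  Adj u v := ∃ i, DifferOnlyAt i u v
  symm := ⟨fun _ _ ⟨i, h, h'⟩ => ⟨i, h.symm, fun j hj => (h' j hj).symm⟩⟩
  loopless := ⟨fun _ ⟨_, h, _⟩ => h rfl⟩

/-- The dimension of the grid on `∏ i, V i`: the number of `i` for which `V i` has more than one
element. -/
def gridDim [Fintype ι] (V : ι → Type*) [∀ i, Fintype (V i)] : ℕ :=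
  (Finset.univ.filter fun i => 1 < Fintype.card (V i)).card

/-- An orientation of the edges of the grid on `∏ i, V i`; `O.arc u v` means `u → v`. -/
structure Orientation (V : ι → Type*) where
  arc : (∀ i, V i) → (∀ i, V i) → Prop
  adj_of_arc : ∀ u v, arc u v → (gridGraph V).Adj u v
  arc_iff : ∀ u v, (gridGraph V).Adj u v → (arc u v ↔ ¬ arc v u)

/-- The vertex `v` lies in the subgrid `∏ i, S i`. -/
def InSubgrid (S : ∀ i, Finset (V i)) (v : ∀ i, V i) : Prop := ∀ i, v i ∈ S i

namespace Orientation

variable (O : Orientation V) (S : ∀ i, Finset (V i))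

/-- `v` is a sink of the subgrid `S`: all its incident edges in `S` are incoming. -/
def IsSink (v : ∀ i, V i) : Prop :=
  InSubgrid S v ∧ ∀ w, InSubgrid S w → (gridGraph V).Adj v w → O.arc w v

/-- `v` is a source of the subgrid `S`: all its incident edges in `S` are outgoing. -/
def IsSource (v : ∀ i, V i) : Prop :=
  InSubgrid S v ∧ ∀ w, InSubgrid S w → (gridGraph V).Adj v w → O.arc v w

/-- Unique sink orientations: every subgrid (with nonempty sides) has a unique sink. -/
def IsUSO : Prop :=
  ∀ S : ∀ i, Finset (V i), (∀ i, (S i).Nonempty) → ∃! v, O.IsSink S v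

/-- `p` is the vertex sequence of a directed path from `s` to `t` inside the subgrid `S`. -/
def IsDipath (s t : ∀ i, V i) (p : List (∀ i, V i)) : Prop :=
  p.head? = some s ∧ p.getLast? = some t ∧ p.IsChain O.arc ∧ p.Nodup ∧
    ∀ v ∈ p, InSubgrid S v

/-- In the subgrid `S` there are `k` pairwise distinct directed paths from `s` to `t`, any two of
which have no vertex in common except `s` and `t`. -/
def HasDisjointDipaths (k : ℕ) (s t : ∀ i, V i) : Prop :=
  ∃ P : Fin k → List (∀ i, V i),
    Function.Injective P ∧ (∀ a, O.IsDipath S s t (P a)) ∧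
      ∀ a b, a ≠ b → ∀ v, v ∈ P a → v ∈ P b → v = s ∨ v = t

/-- Admissible orientations: unique sink orientations such that in each subgrid of size
`(n₁, …, nᵣ)` (all `nᵢ ≥ 1`, so that the subtraction is not truncated) there are
`n₁ + ⋯ + nᵣ - r` internally disjoint directed paths from the unique source to the unique sink. -/
def IsAdmissible [Fintype ι] : Prop :=
  O.IsUSO ∧ ∀ S : ∀ i, Finset (V i), (∀ i, (S i).Nonempty) →
    ∃ s t, (O.IsSource S s ∧ ∀ s', O.IsSource S s' → s' = s) ∧
      (O.IsSink S t ∧ ∀ t', O.IsSink S t' → t' = t) ∧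
      O.HasDisjointDipaths S ((∑ i, (S i).card) - Fintype.card ι) s t

end Orientation

end Grid

/-! ### Signotopes -/

/-- Maps from the `r`-element subsets of an `n`-element linearly ordered set to `{-, +}`; here
`true` stands for `+` and `false` for `-`. -/
abbrev SignMap (n r : ℕ) : Type := {A : Finset (Fin n) // A.card = r} → Bool

/-- The sequence `χ(A)` for an `(r+1)`-subset `A`: its `i`-th entry is the sign of `A` without its
`i`-th smallest element. -/
def signSeq {n r : ℕ} (χ : SignMap n r) (A : {A : Finset (Fin n) // A.card = r + 1})
    (i : Fin (r + 1)) : Bool :=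
  χ ⟨A.1.erase (A.1.orderEmbOfFin A.2 i), by
    rw [Finset.card_erase_of_mem (Finset.orderEmbOfFin_mem _ _ _), A.2]; rfl⟩

/-- Signotopes of rank `r`: for each `(r+1)`-subset `A`, the sequence `χ(A)` has at most one sign
change. -/
def IsSignotope {n r : ℕ} (χ : SignMap n r) : Prop :=
  ∀ A, (Finset.univ.filter fun i : Fin r =>
    signSeq χ A i.castSucc ≠ signSeq χ A i.succ).card ≤ 1

/-- Block partitions: partitions of `Fin n` into nonempty blocks `C 0, …, C (r-1)` such that every
element of an earlier block is smaller than every element of a later one. -/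
structure IsBlockPartition {n r : ℕ} (C : Fin r → Finset (Fin n)) : Prop where
  nonempty : ∀ i, (C i).Nonempty
  cover : ∀ x, ∃ i, x ∈ C i
  lt : ∀ i j, i < j → ∀ x ∈ C i, ∀ y ∈ C j, x < y

section Induced

variable {n r : ℕ} {C : Fin r → Finset (Fin n)}

/-- The set `{c₁, …, cᵣ}` of the coordinates of a vertex `(c₁, …, cᵣ)` of `C₁ × ⋯ × Cᵣ`. -/
def coordSet (u : ∀ i, C i) : Finset (Fin n) := Finset.univ.image fun i => (u i : Fin n)

theorem IsBlockPartition.eq_of_mem (hC : IsBlockPartition C) {i j : Fin r} {x : Fin n}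
    (hi : x ∈ C i) (hj : x ∈ C j) : i = j := by
  rcases lt_trichotomy i j with h | h | h
  · exact absurd (hC.lt i j h x hi x hj) (lt_irrefl _)
  · exact h
  · exact absurd (hC.lt j i h x hj x hi) (lt_irrefl _)

theorem card_coordSet (hC : IsBlockPartition C) (u : ∀ i, C i) : (coordSet u).card = r := by
  unfold coordSet
  rw [Finset.card_image_of_injective, Finset.card_univ, Fintype.card_fin]
  intro i j h
  have h' : (u i : Fin n) = u j := h
  exact hC.eq_of_mem (u i).2 (h' ▸ (u j).2)

theorem coordSet_union (i : Fin r) (u v : ∀ i, C i) (h : DifferOnlyAt i u v) :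
    coordSet u ∪ coordSet v = insert (v i : Fin n) (coordSet u) := by
  ext x
  simp only [coordSet, Finset.mem_union, Finset.mem_image, Finset.mem_univ, true_and,
    Finset.mem_insert]
  constructor
  · rintro (⟨j, rfl⟩ | ⟨j, rfl⟩)
    · exact Or.inr ⟨j, rfl⟩
    · by_cases hj : j = i
      · subst hj; exact Or.inl rfl
      · exact Or.inr ⟨j, by rw [h.2 j hj]⟩
  · rintro (rfl | ⟨j, rfl⟩)
    · exact Or.inr ⟨i, rfl⟩
    · exact Or.inl ⟨j, rfl⟩

/-- The coordinates of the two ends of an edge form an `(r+1)`-set. -/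
theorem card_coordSet_union (hC : IsBlockPartition C) (i : Fin r) (u v : ∀ i, C i)
    (h : DifferOnlyAt i u v) : (coordSet u ∪ coordSet v).card = r + 1 := by
  rw [coordSet_union i u v h, Finset.card_insert_of_notMem, card_coordSet hC]
  simp only [coordSet, Finset.mem_image, Finset.mem_univ, true_and, not_exists]
  intro j hj
  have hji : j = i := hC.eq_of_mem (u j).2 (hj ▸ (v i).2)
  subst hji
  exact h.1 (Subtype.ext hj)

/-- The arcs of the orientation `O_χ`: for vertices `u = (c₁, …, c, …, cᵣ)` and
`v = (c₁, …, c', …, cᵣ)` that differ exactly in coordinate `i`, one has `u → v` if `c < c'` and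
`χ(c₁, …, c, c', …, cᵣ) = +`, or `c' < c` and `χ(c₁, …, c', c, …, cᵣ) = -`. -/
def inducedArc (χ : SignMap n (r + 1)) (hC : IsBlockPartition C) (u v : ∀ i, C i) : Prop :=
  ∃ (i : Fin r) (h : DifferOnlyAt i u v),
    (u i < v i ∧ χ ⟨coordSet u ∪ coordSet v, card_coordSet_union hC i u v h⟩ = true) ∨
    (v i < u i ∧ χ ⟨coordSet u ∪ coordSet v, card_coordSet_union hC i u v h⟩ = false)

/-- The orientation `O_χ` of the grid on `C₁ × ⋯ × Cᵣ` induced by a map `χ` on `(r+1)`-sets. -/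
def inducedOrientation (χ : SignMap n (r + 1)) (hC : IsBlockPartition C) :
    Orientation (fun i => C i) where
  arc := inducedArc χ hC
  adj_of_arc := fun _ _ ⟨i, h, _⟩ => ⟨i, h⟩
  arc_iff := by
    rintro u v ⟨i, h⟩
    have huv := card_coordSet_union hC i u v h
    have key : ∀ (b : Bool) (w w' : ∀ i, C i) (hw : (coordSet w ∪ coordSet w').card = r + 1)
        (hw' : (coordSet w' ∪ coordSet w).card = r + 1),
        χ ⟨coordSet w ∪ coordSet w', hw⟩ = b ↔ χ ⟨coordSet w' ∪ coordSet w, hw'⟩ = b := by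
      intro b w w' hw hw'
      have : (⟨coordSet w ∪ coordSet w', hw⟩ : {A : Finset (Fin n) // A.card = r + 1}) =
          ⟨coordSet w' ∪ coordSet w, hw'⟩ := Subtype.ext (Finset.union_comm _ _)
      rw [this]
    have huniq : ∀ j, u j ≠ v j → j = i := fun j hj => by
      by_contra hne
      exact hj (h.2 j hne)
    have h1 : inducedArc χ hC u v ↔ (u i < v i ∧ χ ⟨coordSet u ∪ coordSet v, huv⟩ = true) ∨
        (v i < u i ∧ χ ⟨coordSet u ∪ coordSet v, huv⟩ = false) := by
      constructor
      · rintro ⟨j, hj, hh⟩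
        obtain rfl := huniq j hj.1
        exact hh
      · exact fun hh => ⟨i, h, hh⟩
    have hvu' : DifferOnlyAt i v u := ⟨h.1.symm, fun j hj => (h.2 j hj).symm⟩
    have h2 : inducedArc χ hC v u ↔ (v i < u i ∧ χ ⟨coordSet u ∪ coordSet v, huv⟩ = true) ∨
        (u i < v i ∧ χ ⟨coordSet u ∪ coordSet v, huv⟩ = false) := by
      constructor
      · rintro ⟨j, hj, hh⟩
        obtain rfl := huniq j hj.1.symm
        rw [key _ v u _ huv, key _ v u _ huv] at hh
        exact hh
      · intro hh
        refine ⟨i, hvu', ?_⟩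
        rw [key _ v u _ huv, key _ v u _ huv]
        exact hh
    rw [h1, h2]
    rcases lt_or_gt_of_ne h.1 with hlt | hlt
    · simp [hlt, hlt.not_gt]
    · simp [hlt, hlt.not_gt]

end Induced

end GridUSO

/-! ### Sign-monotone orientations and acyclicity -/

namespace GridUSO

section Grid

variable {ι : Type*} {V : ι → Type*}

/-! Give an edge the sign + if it points to the larger entry. A square of the grid involves r+2
elements of [n], and deleting one of them in each of the four ways gives the sets of its four edges.
By the signotope axiom, moving a p-edge along an arc of dimension q never lowers its sign if p < q
and never raises it if p > q. Three vertices on a line give transitivity in the same way. These two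
properties, `IsSignMonotone`, are all that is used of χ.

Acyclicity holds in every dimension, by peeling off the top layer of the largest nontrivial
dimension (`exists_forall_not_arc`); it gives sinks and, by reversal, sources. Two sinks differ in
at most three coordinates, and carrying an arc at one of them over to the other gives a
contradiction (`isSink_unique`).

Each out-neighbour of the source s, with new entry x in coordinate i, starts one path to the sink t.
If x ≠ t i, the inner vertices stay in the layer x (`exists_slab_path`); if x = t i, the path stays
in the cube spanned by s and t (`exists_cube_paths`). Write s+j for s with coordinate j taken from
t, and t-k for t with coordinate k taken from s. In a 3-cube the paths are s, s+i, t-π(i), t for a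
cyclic permutation π of the dimensions; the direction of the middle dimension decides which of the
two works. -/

theorem DifferOnlyAt.symm {i : ι} {u v : ∀ i, V i} (h : DifferOnlyAt i u v) :
    DifferOnlyAt i v u :=
  ⟨h.1.symm, fun j hj => (h.2 j hj).symm⟩

theorem DifferOnlyAt.adj {i : ι} {u v : ∀ i, V i} (h : DifferOnlyAt i u v) :
    (gridGraph V).Adj u v := ⟨i, h⟩

theorem differOnlyAt_update [DecidableEq ι] {i : ι} {u : ∀ i, V i} {x : V i} (h : u i ≠ x) :
    DifferOnlyAt i u (Function.update u i x) :=
  ⟨by simpa using h, fun j hj => by simp [hj]⟩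

theorem DifferOnlyAt.update [DecidableEq ι] {i l : ι} {u v : ∀ i, V i} (h : DifferOnlyAt i u v)
    (hl : l ≠ i) (y : V l) :
    DifferOnlyAt i (Function.update u l y) (Function.update v l y) := by
  refine ⟨by simpa [hl.symm] using h.1, fun j hj => ?_⟩
  by_cases hjl : j = l
  · subst hjl; simp
  · simpa [hjl] using h.2 j hj

namespace Orientation

variable (O : Orientation V)

theorem not_arc_of_arc {O : Orientation V} {u v : ∀ i, V i} (h : O.arc u v) : ¬ O.arc v u :=
  (O.arc_iff u v (O.adj_of_arc u v h)).1 h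

theorem arc_of_not_arc {O : Orientation V} {i : ι} {u v : ∀ i, V i} (h : DifferOnlyAt i u v)
    (h' : ¬ O.arc v u) : O.arc u v :=
  (O.arc_iff u v h.adj).2 h'

/-- The orientation with all arcs reversed. -/
def reverse : Orientation V where
  arc u v := O.arc v u
  adj_of_arc _ _ h := (O.adj_of_arc _ _ h).symm
  arc_iff _ _ h := O.arc_iff _ _ h.symm

theorem isSink_reverse (S : ∀ i, Finset (V i)) (v : ∀ i, V i) :
    O.reverse.IsSink S v ↔ O.IsSource S v := Iff.rfl

/-- On every line the arcs are transitive, and the direction of an edge of dimension `p`, as a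
sign with respect to the order of `V p`, increases along the arcs of dimension `q > p` and
decreases along the arcs of dimension `q < p`. -/
structure IsSignMonotone [LT ι] [∀ i, LT (V i)] : Prop where
  line : ∀ {p : ι} {a b c : ∀ i, V i}, DifferOnlyAt p a b → DifferOnlyAt p b c →
    DifferOnlyAt p a c → O.arc a b → O.arc b c → O.arc a c
  square : ∀ {p q : ι} {a b a' b' : ∀ i, V i}, p ≠ q → DifferOnlyAt p a b →
    DifferOnlyAt p a' b' → DifferOnlyAt q a a' → DifferOnlyAt q b b' → (p < q ↔ a p < b p) →
    O.arc a b → (O.arc a a' ∨ O.arc b b') → O.arc a' b'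

variable {O} [LinearOrder ι] [∀ i, LinearOrder (V i)]

/-- Contrapositive of `square`: an edge of the other sign can be pulled back along an arc, where
`square` pushes forward. -/
theorem IsSignMonotone.square' (hO : O.IsSignMonotone) {p q : ι} {a b a' b' : ∀ i, V i}
    (hpq : p ≠ q) (hab : DifferOnlyAt p a b) (hab' : DifferOnlyAt p a' b')
    (ha : DifferOnlyAt q a a') (hb : DifferOnlyAt q b b') (hm : ¬ (p < q ↔ a p < b p))
    (h : O.arc a' b') (h' : O.arc a a' ∨ O.arc b b') : O.arc a b := by
  by_contra hn
  have h1 := arc_of_not_arc hab.symm hn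
  refine not_arc_of_arc h (hO.square hpq hab.symm hab'.symm hb ha ?_ h1 h'.symm)
  have := hab.1
  grind

/-- Reversal negates the signs and also the direction of travel, so the two effects cancel.
Statements about sinks thus transfer to sources. -/
theorem IsSignMonotone.reverse (hO : O.IsSignMonotone) : O.reverse.IsSignMonotone where
  line hab hbc hac h h' := hO.line hbc.symm hab.symm hac.symm h' h
  square := by
    intro p q a b a' b' hpq hab hab' ha hb hm h h'
    change O.arc b' a'
    refine hO.square' hpq hab'.symm hab.symm hb.symm ha.symm ?_ h h'.symm
    have h1 := ha.2 p hpq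
    have h2 := hb.2 p hpq
    have := hab.1
    rw [← h1, ← h2]
    grind

/-- Acyclicity: every nonempty set of vertices contains one without arcs into that set. -/
theorem IsSignMonotone.exists_forall_not_arc [Fintype ι] (hO : O.IsSignMonotone)
    (S : ∀ i, Finset (V i)) (T : Set (∀ i, V i)) (hT : T.Nonempty)
    (hTS : ∀ v ∈ T, InSubgrid S v) : ∃ v ∈ T, ∀ w ∈ T, ¬ O.arc v w := by
  induction hN : ∑ i, (S i).card using Nat.strong_induction_on generalizing S T with
  | _ N ih =>
  subst hN
  by_cases hS : ∃ i, 1 < (S i).card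
  · obtain ⟨p, hp, hmax⟩ : ∃ p, 1 < (S p).card ∧ ∀ q, 1 < (S q).card → q ≤ p := by
      obtain ⟨i, hi⟩ := hS
      obtain ⟨p, hp, hmax⟩ := (Finset.univ.filter fun i => 1 < (S i).card).exists_max_image id
        ⟨i, by simpa using hi⟩
      exact ⟨p, by simpa using hp, fun q hq => hmax q (by simpa using hq)⟩
    have hne : (S p).Nonempty := Finset.card_pos.1 (by omega)
    set c := (S p).max' hne with hc
    have hcS : c ∈ S p := Finset.max'_mem _ _
    have hlt : ∀ S' : Finset (V p), S'.card < (S p).card →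
        ∑ i, (Function.update S p S' i).card < ∑ i, (S i).card := by
      intro S' hS'
      refine Finset.sum_lt_sum (fun i _ => ?_) ⟨p, Finset.mem_univ _, by simpa using hS'⟩
      by_cases hi : i = p
      · subst hi; simpa using hS'.le
      · simp [hi]
    have hsub : ∀ (S' : Finset (V p)) v, InSubgrid S v → v p ∈ S' →
        InSubgrid (Function.update S p S') v := by
      intro S' v hv hvp i
      by_cases hi : i = p
      · subst hi; simpa using hvp
      · simpa [hi] using hv i
    have ih1 := fun T' hT' h => ih _ (hlt ((S p).erase c) (Finset.card_erase_lt_of_mem hcS)) _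
      T' hT' h rfl
    have ih2 := fun T' hT' h => ih _ (hlt {c} (by simpa using hp)) _ T' hT' h rfl
    have hd : ∀ v : ∀ i, V i, v p ≠ c → DifferOnlyAt p v (Function.update v p c) :=
      fun v hv => differOnlyAt_update hv
    have hdc : ∀ v w : ∀ i, V i, v p ≠ c → w p = c → O.arc v w ∨ O.arc w v →
        w = Function.update v p c := by
      intro v w hv hw h
      have hadj : (gridGraph V).Adj v w := by
        rcases h with h | h
        · exact O.adj_of_arc _ _ h
        · exact (O.adj_of_arc _ _ h).symm
      obtain ⟨i, hi⟩ := hadj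
      have hip : p = i := by
        by_contra hne
        exact hv ((hi.2 p hne).trans hw)
      subst hip
      funext j
      by_cases hj : j = p
      · subst hj; simpa using hw
      · simpa [hj] using (hi.2 j hj).symm
    -- Consider the vertices below layer c that receive an arc from their projection to it, a p-edge
    -- of sign -. Within T no arc leaves this set: the sign stays - along other dimensions,
    -- transitivity handles dimension p, and the only edge to layer c is incoming. So a sink of this
    -- set is a sink of T.
    by_cases h1 : ∃ v ∈ T, v p ≠ c ∧ O.arc (Function.update v p c) v
    · obtain ⟨v, ⟨hvT, hvc, hv⟩, hsink⟩ := ih1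
        {v | v ∈ T ∧ v p ≠ c ∧ O.arc (Function.update v p c) v} h1
        fun v hv => hsub _ _ (hTS v hv.1) (by simpa [hv.2.1] using hTS v hv.1 p)
      refine ⟨v, hvT, fun w hw hvw => ?_⟩
      by_cases hwc : w p = c
      · rw [hdc v w hvc hwc (Or.inl hvw)] at hvw
        exact not_arc_of_arc hvw hv
      · refine hsink w ⟨hw, hwc, ?_⟩ hvw
        obtain ⟨q, hq⟩ := O.adj_of_arc _ _ hvw
        by_cases hqp : q = p
        · subst hqp
          have he : Function.update w q c = Function.update v q c := by
            funext j
            by_cases hj : j = q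
            · subst hj; simp
            · simpa [hj] using (hq.2 j hj).symm
          rw [he]
          exact hO.line (hd v hvc).symm hq (he ▸ (hd w hwc).symm) hv hvw
        · have hqS : 1 < (S q).card :=
            Finset.one_lt_card.2 ⟨v q, hTS v hvT q, w q, hTS w hw q, hq.1⟩
          have hlt' : q < p := lt_of_le_of_ne (hmax q hqS) hqp
          refine hO.square (Ne.symm hqp) (hd v hvc).symm (hd w hwc).symm
            (hq.update (Ne.symm hqp) c) hq ?_ hv (Or.inr hvw)
          have : v p ≤ c := Finset.le_max' _ _ (hTS v hvT p)
          simp [hlt'.not_gt, this]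
    -- Now no arc of T leaves layer c, so a sink of that layer suffices if T meets it.
    · by_cases h2 : ∃ v ∈ T, v p = c
      · obtain ⟨v, ⟨hvT, hvc⟩, hsink⟩ := ih2 {v | v ∈ T ∧ v p = c} h2
          fun v hv => hsub _ _ (hTS v hv.1) (by simpa using hv.2)
        refine ⟨v, hvT, fun w hw hvw => ?_⟩
        by_cases hwc : w p = c
        · exact hsink w ⟨hw, hwc⟩ hvw
        · refine h1 ⟨w, hw, hwc, ?_⟩
          rwa [← hdc w v hwc hvc (Or.inr hvw)]
      · refine ih1 T hT fun v hv => hsub _ _ (hTS v hv) ?_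
        exact Finset.mem_erase.2 ⟨fun h => h2 ⟨v, hv, h⟩, hTS v hv p⟩
  · obtain ⟨v, hv⟩ := hT
    refine ⟨v, hv, fun w hw h => ?_⟩
    obtain ⟨i, hi⟩ := O.adj_of_arc _ _ h
    exact hS ⟨i, Finset.one_lt_card.2 ⟨v i, hTS v hv i, w i, hTS w hw i, hi.1⟩⟩

theorem IsSignMonotone.exists_isSink [Fintype ι] (hO : O.IsSignMonotone)
    (S : ∀ i, Finset (V i)) (hS : ∀ i, (S i).Nonempty) : ∃ v, O.IsSink S v := by
  choose x hx using hS
  obtain ⟨v, hv, h⟩ := hO.exists_forall_not_arc S {v | InSubgrid S v} ⟨x, hx⟩ fun _ hv => hv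
  refine ⟨v, hv, fun w hw hvw => ?_⟩
  obtain ⟨i, hi⟩ := hvw
  exact arc_of_not_arc hi.symm (h w hw)

/-- The vertices lying on a common closed walk with v would form a set in which every vertex has an
outgoing arc. -/
theorem IsSignMonotone.not_transGen [Fintype ι] [∀ i, Fintype (V i)] (hO : O.IsSignMonotone)
    (v : ∀ i, V i) : ¬ Relation.TransGen O.arc v v := by
  intro hv
  obtain ⟨w, ⟨hw1, hw2⟩, h⟩ := hO.exists_forall_not_arc (fun _ => Finset.univ)
    {w | Relation.TransGen O.arc v w ∧ Relation.TransGen O.arc w v} ⟨v, hv, hv⟩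
    fun w _ i => Finset.mem_univ _
  obtain ⟨x, hwx, hx⟩ := Relation.TransGen.head'_iff.1 hw2
  refine h x ⟨hw1.tail hwx, ?_⟩ hwx
  rcases Relation.reflTransGen_iff_eq_or_transGen.1 hx with rfl | hx
  · exact hv
  · exact hx

theorem IsSignMonotone.nodup [Fintype ι] [∀ i, Fintype (V i)] (hO : O.IsSignMonotone)
    {p : List (∀ i, V i)} (hp : p.IsChain O.arc) : p.Nodup := by
  have h1 : p.IsChain (Relation.TransGen O.arc) := hp.imp fun _ _ h => Relation.TransGen.single h
  have h2 : p.Pairwise (Relation.TransGen O.arc) := List.isChain_iff_pairwise.1 h1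
  refine h2.imp ?_
  rintro a _ h rfl
  exact hO.not_transGen a h

end Orientation

end Grid

end GridUSO

/-! ### Uniqueness of sinks, and paths through slabs -/

namespace GridUSO

section Grid

variable {ι : Type*} {V : ι → Type*}

namespace Orientation

variable {O : Orientation V}

theorem InSubgrid.update [DecidableEq ι] {S : ∀ i, Finset (V i)} {v : ∀ i, V i}
    (hv : InSubgrid S v) {i : ι} {x : V i} (hx : x ∈ S i) :
    InSubgrid S (Function.update v i x) := by
  intro l
  by_cases hl : l = i
  · subst hl; simpa using hx
  · simpa [hl] using hv l

theorem IsSink.arc_update [DecidableEq ι] {S : ∀ i, Finset (V i)} {t : ∀ i, V i}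
    (ht : O.IsSink S t) {i : ι} {x : V i} (hx : x ∈ S i) (hne : t i ≠ x) :
    O.arc (Function.update t i x) t :=
  ht.2 _ (InSubgrid.update ht.1 hx) (differOnlyAt_update hne).adj

theorem IsSource.arc_update [DecidableEq ι] {S : ∀ i, Finset (V i)} {s : ∀ i, V i}
    (hs : O.IsSource S s) {i : ι} {x : V i} (hx : x ∈ S i) (hne : s i ≠ x) :
    O.arc s (Function.update s i x) :=
  hs.2 _ (InSubgrid.update hs.1 hx) (differOnlyAt_update hne).adj

variable [LinearOrder ι] [∀ i, LinearOrder (V i)]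

/-- A square does not have two sinks. -/
theorem IsSignMonotone.square_sinks (hO : O.IsSignMonotone) {p q : ι} {a b a' b' : ∀ i, V i}
    (hpq : p ≠ q) (hab : DifferOnlyAt p a b) (hab' : DifferOnlyAt p a' b')
    (ha : DifferOnlyAt q a a') (hb : DifferOnlyAt q b b')
    (h1 : O.arc b a) (h2 : O.arc a' a) (h3 : O.arc a' b') (h4 : O.arc b b') : False := by
  refine not_arc_of_arc h1 ?_
  by_cases hm : p < q ↔ a p < b p
  · refine hO.square hpq hab' hab ha.symm hb.symm ?_ h3 (Or.inl h2)
    rwa [← ha.2 p hpq, ← hb.2 p hpq]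
  · exact hO.square' hpq hab hab' ha hb hm h3 (Or.inr h4)

/-- A square does not have two sources. -/
theorem IsSignMonotone.square_sources (hO : O.IsSignMonotone) {p q : ι} {a b a' b' : ∀ i, V i}
    (hpq : p ≠ q) (hab : DifferOnlyAt p a b) (hab' : DifferOnlyAt p a' b')
    (ha : DifferOnlyAt q a a') (hb : DifferOnlyAt q b b')
    (h1 : O.arc a b) (h2 : O.arc a a') (h3 : O.arc b' a') (h4 : O.arc b' b) : False :=
  hO.reverse.square_sinks hpq hab hab' ha hb h1 h2 h3 h4

/-- A 3-cube does not have two antipodal sinks, provided that the sign in dimension `i` changes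
differently along the arcs of the two other dimensions. -/
theorem IsSignMonotone.cube_sinks (hO : O.IsSignMonotone) {S : ∀ i, Finset (V i)}
    {s t : ∀ i, V i} (hs : O.IsSink S s) (ht : O.IsSink S t) {i j k : ι} (hij : i ≠ j)
    (hik : i ≠ k) (hjk : j ≠ k) (hi : s i ≠ t i) (hj : s j ≠ t j) (hk : s k ≠ t k)
    (hst : ∀ l, l ≠ i → l ≠ j → l ≠ k → s l = t l) (h1 : i < j ↔ s i < t i)
    (h2 : ¬ (i < k ↔ s i < t i)) : False := by
  have e1 : DifferOnlyAt i (Function.update s j (t j)) (Function.update t k (s k)) := by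
    refine ⟨?_, fun l hl => ?_⟩ <;> grind [Function.update]
  -- The i-arc into t is pulled back along the k-arc into t; pushed on along the j-arc into s, it
  -- becomes an i-arc leaving s.
  have e2 : O.arc (Function.update s j (t j)) (Function.update t k (s k)) := by
    refine hO.square' (q := k) (a' := Function.update t i (s i)) (b' := t) hik e1
      (differOnlyAt_update hi.symm).symm ?_ (differOnlyAt_update hk.symm).symm ?_
      (ht.arc_update (hs.1 i) hi.symm) (Or.inr (ht.arc_update (hs.1 k) hk.symm))
    · refine ⟨?_, fun l hl => ?_⟩ <;> grind [Function.update]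
    · grind [Function.update]
  refine not_arc_of_arc (hs.arc_update (ht.1 i) hi) ?_
  refine hO.square (q := j) hij e1 (differOnlyAt_update hi) (differOnlyAt_update hj).symm ?_ ?_
    e2 (Or.inl (hs.arc_update (ht.1 j) hj))
  · refine ⟨?_, fun l hl => ?_⟩ <;> grind [Function.update]
  · grind [Function.update]

theorem exists_lt_lt_of_card_eq_three {D : Finset ι} (hD : D.card = 3) :
    ∃ a b c, a < b ∧ b < c ∧ D = {a, b, c} := by
  refine ⟨D.orderEmbOfFin hD 0, D.orderEmbOfFin hD 1, D.orderEmbOfFin hD 2, by simp, by simp, ?_⟩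
  ext x
  rw [← Finset.mem_coe, ← Finset.range_orderEmbOfFin D hD, Set.mem_range]
  simp only [Finset.mem_insert, Finset.mem_singleton]
  constructor
  · rintro ⟨i, rfl⟩
    fin_cases i <;> simp
  · rintro (rfl | rfl | rfl) <;> exact ⟨_, rfl⟩

variable [Fintype ι]

theorem IsSignMonotone.isSink_unique (hO : O.IsSignMonotone) {S : ∀ i, Finset (V i)}
    {s t : ∀ i, V i} (hs : O.IsSink S s) (ht : O.IsSink S t)
    (hD : (Finset.univ.filter fun i => s i ≠ t i).card ≤ 3) : s = t := by
  set D := Finset.univ.filter fun i => s i ≠ t i with hDdef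
  have hmem : ∀ l, l ∈ D ↔ s l ≠ t l := by simp [D]
  by_contra hne
  have hpos : D.card ≠ 0 := fun h => hne <| funext fun l => by
    by_contra hl
    rw [Finset.card_eq_zero] at h
    simpa [h] using (hmem l).2 hl
  obtain h | h | h : D.card = 1 ∨ D.card = 2 ∨ D.card = 3 := by omega
  · obtain ⟨i, hi⟩ := Finset.card_eq_one.1 h
    simp only [hi, Finset.mem_singleton] at hmem
    have : DifferOnlyAt i s t := ⟨(hmem i).1 rfl, fun l hl => by grind⟩
    exact not_arc_of_arc (hs.2 t ht.1 this.adj) (ht.2 s hs.1 this.symm.adj)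
  · obtain ⟨i, j, hij, hi⟩ := Finset.card_eq_two.1 h
    simp only [hi, Finset.mem_insert, Finset.mem_singleton] at hmem
    have hi := (hmem i).1 (Or.inl rfl)
    have hj := (hmem j).1 (Or.inr rfl)
    have e1 : DifferOnlyAt i (Function.update s j (t j)) t := by
      refine ⟨?_, fun l hl => ?_⟩ <;> grind [Function.update]
    have e2 : DifferOnlyAt j (Function.update s i (t i)) t := by
      refine ⟨?_, fun l hl => ?_⟩ <;> grind [Function.update]
    exact hO.square_sinks hij (differOnlyAt_update hi) e1 (differOnlyAt_update hj) e2
      (hs.arc_update (ht.1 i) hi) (hs.arc_update (ht.1 j) hj)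
      (ht.2 _ (InSubgrid.update hs.1 (ht.1 j)) e1.symm.adj)
      (ht.2 _ (InSubgrid.update hs.1 (ht.1 i)) e2.symm.adj)
  · obtain ⟨a, b, c, hab, hbc, hi⟩ := exists_lt_lt_of_card_eq_three h
    simp only [hi, Finset.mem_insert, Finset.mem_singleton] at hmem
    have ha := (hmem a).1 (by simp)
    have hb := (hmem b).1 (by simp)
    have hc := (hmem c).1 (by simp)
    -- The middle dimension has one dimension on each side, as `cube_sinks` requires; the sign
    -- decides which of them plays j.
    by_cases hm : s b < t b
    · exact hO.cube_sinks hs ht hbc.ne hab.ne' (hab.trans hbc).ne' hb hc ha (by grind)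
        (by simp [hm, hbc]) (by simp [hm, hab.le])
    · exact hO.cube_sinks hs ht hab.ne' hbc.ne (hab.trans hbc).ne hb ha hc (by grind)
        (by simp [hm, hab.le]) (by simp [hm, hbc])

/-- Some path from `s` to `t` whose second vertex is `s` with `x` in coordinate `i`, and whose
inner vertices have `x` in coordinate `i` and agree with `s` or `t` in the others. -/
theorem IsSignMonotone.exists_slab_path [∀ i, Fintype (V i)] (hO : O.IsSignMonotone)
    {S : ∀ i, Finset (V i)} {s t : ∀ i, V i} (hs : O.IsSource S s) (ht : O.IsSink S t)
    {i : ι} {x : V i} (hx : x ∈ S i) (hxs : s i ≠ x) (hxt : t i ≠ x)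
    (hE : (Finset.univ.filter fun l => l ≠ i ∧ s l ≠ t l).card ≤ 2) :
    ∃ q, O.IsDipath S s t (s :: Function.update s i x :: q) ∧
      ∀ v ∈ s :: Function.update s i x :: q,
        v = s ∨ v = t ∨ v i = x ∧ ∀ l, l ≠ i → v l = s l ∨ v l = t l := by
  set E := Finset.univ.filter fun l => l ≠ i ∧ s l ≠ t l with hEdef
  have hmem : ∀ l, l ∈ E ↔ l ≠ i ∧ s l ≠ t l := by simp [E]
  set s' := Function.update s i x with hs'
  set t' := Function.update t i x with ht'
  have hss : O.arc s s' := hs.arc_update hx hxs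
  have htt : O.arc t' t := ht.arc_update hx hxt
  have ds : DifferOnlyAt i s s' := differOnlyAt_update hxs
  have dt : DifferOnlyAt i t t' := differOnlyAt_update hxt
  have aS : ∀ l, s l ≠ t l → O.arc s (Function.update s l (t l)) :=
    fun l hl => hs.arc_update (ht.1 l) hl
  have aT : ∀ l, s l ≠ t l → O.arc (Function.update t l (s l)) t :=
    fun l hl => ht.arc_update (hs.1 l) hl.symm
  have hS's : InSubgrid S s' := InSubgrid.update hs.1 hx
  have hS't : InSubgrid S t' := InSubgrid.update ht.1 hx
  obtain h | h | h : E.card = 0 ∨ E.card = 1 ∨ E.card = 2 := by omega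
  · rw [Finset.card_eq_zero] at h
    have hst : s' = t' := by
      funext l
      have := hmem l
      grind [Function.update]
    have hst' : O.arc s' t := hst ▸ htt
    have hchain : List.IsChain O.arc [s, s', t] := by simp [hss, hst']
    refine ⟨[t], ⟨by simp, by simp, hchain, hO.nodup hchain, by simp [hs.1, ht.1, hS's]⟩, ?_⟩
    simp only [List.mem_cons, List.not_mem_nil, or_false]
    rintro v (rfl | rfl | rfl) <;> grind [Function.update]
  · obtain ⟨j, hj⟩ := Finset.card_eq_one.1 h
    simp only [hj, Finset.mem_singleton] at hmem
    obtain ⟨hji, hjst⟩ := (hmem j).1 rfl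
    have d : DifferOnlyAt j s' t' := by
      refine ⟨?_, fun l hl => ?_⟩ <;> grind [Function.update]
    have harc : O.arc s' t' := by
      by_cases hm : j < i ↔ s j < t j
      · refine hO.square hji (differOnlyAt_update hjst) d ds ?_ (by simpa using hm) (aS j hjst)
          (Or.inl hss)
        refine ⟨?_, fun l hl => ?_⟩ <;> grind [Function.update]
      · refine hO.square' hji d (differOnlyAt_update hjst.symm).symm ?_ dt.symm ?_ (aT j hjst)
          (Or.inr htt)
        · refine ⟨?_, fun l hl => ?_⟩ <;> grind [Function.update]
        · grind [Function.update]
    have hchain : List.IsChain O.arc [s, s', t', t] := by simp [hss, harc, htt]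
    refine ⟨[t', t], ⟨by simp, by simp, hchain, hO.nodup hchain, ?_⟩, ?_⟩
    · simp [hs.1, ht.1, hS's, hS't]
    · simp only [List.mem_cons, List.not_mem_nil, or_false]
      rintro v (rfl | rfl | rfl | rfl) <;> grind [Function.update]
  · obtain ⟨j, k, hjk, hjke⟩ := Finset.card_eq_two.1 h
    simp only [hjke, Finset.mem_insert, Finset.mem_singleton] at hmem
    obtain ⟨hji, hjst⟩ := (hmem j).1 (Or.inl rfl)
    obtain ⟨hki, hkst⟩ := (hmem k).1 (Or.inr rfl)
    -- Either the first j-arc at s is pushed into the slab along s → s', or the last j-arc at t is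
    -- pulled back along t' → t.
    have key : ∀ j k : ι, (∀ l, l = j ∨ l = k ↔ l ≠ i ∧ s l ≠ t l) → j ≠ k → j ≠ i → k ≠ i →
        s j ≠ t j → s k ≠ t k →
        (j < i ↔ s j < t j) ∧ O.arc s' (Function.update s' j (t j)) ∨
        ¬ (j < i ↔ s j < t j) ∧ O.arc (Function.update s' k (t k)) t' := by
      intro j k hmem hjk hji hki hjst hkst
      by_cases hm : j < i ↔ s j < t j
      · refine Or.inl ⟨hm, ?_⟩
        refine hO.square hji (differOnlyAt_update hjst) ?_ ds (ds.update hji _)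
          (by simpa using hm) (aS j hjst) (Or.inl hss)
        refine ⟨?_, fun l hl => ?_⟩ <;> grind [Function.update]
      · refine Or.inr ⟨hm, ?_⟩
        refine hO.square' hji ?_ (differOnlyAt_update hjst.symm).symm ?_ dt.symm ?_ (aT j hjst)
          (Or.inr htt)
        · refine ⟨?_, fun l hl => ?_⟩ <;> grind [Function.update]
        · refine ⟨?_, fun l hl => ?_⟩ <;> grind [Function.update]
        · grind [Function.update]
    have d1 : DifferOnlyAt j s' (Function.update s' j (t j)) :=
      differOnlyAt_update (by simpa [hs', hji] using hjst)
    have d2 : DifferOnlyAt k s' (Function.update s' k (t k)) :=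
      differOnlyAt_update (by simpa [hs', hki] using hkst)
    have d3 : DifferOnlyAt k (Function.update s' j (t j)) t' := by
      refine ⟨?_, fun l hl => ?_⟩ <;> grind [Function.update]
    have d4 : DifferOnlyAt j (Function.update s' k (t k)) t' := by
      refine ⟨?_, fun l hl => ?_⟩ <;> grind [Function.update]
    obtain ⟨m, hm1, hm2, hm⟩ : ∃ m, O.arc s' m ∧ O.arc m t' ∧
        (m = Function.update s' j (t j) ∨ m = Function.update s' k (t k)) := by
      have k1 := key j k hmem hjk hji hki hjst hkst
      have k2 := key k j (by grind) hjk.symm hki hji hkst hjst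
      by_contra hn
      push Not at hn
      have n1 := fun h h' => (hn _ h h').1 rfl
      have n2 := fun h h' => (hn _ h h').2 rfl
      -- Mixed outcomes of `key` form a path from s' to t'. With equal outcomes, failure of both
      -- paths gives a square with two sources or two sinks.
      obtain ⟨-, k1⟩ | ⟨-, k1⟩ := k1 <;> obtain ⟨-, k2⟩ | ⟨-, k2⟩ := k2
      · exact hO.square_sources hjk d1 d4 d2 d3 k1 k2 (arc_of_not_arc d4.symm (n2 k2))
          (arc_of_not_arc d3.symm (n1 k1))
      · exact n1 k1 k2
      · exact n2 k2 k1
      · exact hO.square_sinks hjk d1 d4 d2 d3 (arc_of_not_arc d1.symm fun h => n1 h k2)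
          (arc_of_not_arc d2.symm fun h => n2 h k1) k1 k2
    have hchain : List.IsChain O.arc [s, s', m, t', t] := by simp [hss, hm1, hm2, htt]
    refine ⟨[m, t', t], ⟨by simp, by simp, hchain, hO.nodup hchain, ?_⟩, ?_⟩
    · have : InSubgrid S m := by
        rcases hm with rfl | rfl
        · exact InSubgrid.update hS's (ht.1 j)
        · exact InSubgrid.update hS's (ht.1 k)
      simp [hs.1, ht.1, hS's, hS't, this]
    · simp only [List.mem_cons, List.not_mem_nil, or_false]
      have hm' : m i = x ∧ ∀ l, l ≠ i → m l = s l ∨ m l = t l := by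
        clear key hchain aS aT
        rcases hm with rfl | rfl <;> grind [Function.update]
      clear key hchain aS aT
      rintro v (rfl | rfl | rfl | rfl | rfl)
      · exact Or.inl rfl
      · grind [Function.update]
      · exact Or.inr (Or.inr hm')
      · grind [Function.update]
      · exact Or.inr (Or.inl rfl)

end Orientation

end Grid

end GridUSO

/-! ### Paths through the cube, and all disjoint paths together -/

namespace GridUSO

section Grid

variable {ι : Type*} {V : ι → Type*}

namespace Orientation

variable {O : Orientation V} [LinearOrder ι] [∀ i, LinearOrder (V i)]

/-- The i-edge from s+j to t-k is parallel to one at s and to one at t; `hm` says that pushing the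
former or pulling back the latter works. If i is the smallest or largest of the three dimensions,
`hm` always holds; if i is the middle one, it holds for exactly one order of j and k. -/
theorem IsSignMonotone.arc_update_update (hO : O.IsSignMonotone) {S : ∀ i, Finset (V i)}
    {s t : ∀ i, V i} (hs : O.IsSource S s) (ht : O.IsSink S t) {i j k : ι} (hij : i ≠ j)
    (hik : i ≠ k) (hjk : j ≠ k) (hi : s i ≠ t i) (hj : s j ≠ t j) (hk : s k ≠ t k)
    (hst : ∀ l, l ≠ i → l ≠ j → l ≠ k → s l = t l)
    (hm : (i < j ↔ s i < t i) ∨ ¬ (i < k ↔ s i < t i)) :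
    O.arc (Function.update s j (t j)) (Function.update t k (s k)) := by
  have e1 : DifferOnlyAt i (Function.update s j (t j)) (Function.update t k (s k)) := by
    refine ⟨?_, fun l hl => ?_⟩ <;> grind [Function.update]
  rcases hm with hm | hm
  · refine hO.square (q := j) hij (differOnlyAt_update hi) e1 (differOnlyAt_update hj) ?_ ?_
      (hs.arc_update (ht.1 i) hi) (Or.inl (hs.arc_update (ht.1 j) hj))
    · refine ⟨?_, fun l hl => ?_⟩ <;> grind [Function.update]
    · simpa using hm
  · refine hO.square' (q := k) (a' := Function.update t i (s i)) (b' := t) hik e1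
      (differOnlyAt_update hi.symm).symm ?_ (differOnlyAt_update hk.symm).symm ?_
      (ht.arc_update (hs.1 i) hi.symm) (Or.inr (ht.arc_update (hs.1 k) hk.symm))
    · refine ⟨?_, fun l hl => ?_⟩ <;> grind [Function.update]
    · grind [Function.update]

variable [Fintype ι]

/-- There are internally disjoint paths from `s` to `t` through the cube spanned by `s` and `t`,
one for each dimension of the cube, whose second vertex differs from `s` in that dimension. -/
def HasCubePaths (O : Orientation V) (S : ∀ i, Finset (V i)) (s t : ∀ i, V i) : Prop :=
  ∃ R : ι → List (∀ i, V i),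
    (∀ i, s i ≠ t i → O.IsDipath S s t (s :: Function.update s i (t i) :: R i)) ∧
    (∀ i, s i ≠ t i → ∀ v ∈ s :: Function.update s i (t i) :: R i, ∀ l, v l = s l ∨ v l = t l) ∧
    ∀ i j, s i ≠ t i → s j ≠ t j → i ≠ j → ∀ v ∈ s :: Function.update s i (t i) :: R i,
      v ∈ s :: Function.update s j (t j) :: R j → v = s ∨ v = t

theorem IsSignMonotone.hasCubePaths_of_cycle [∀ i, Fintype (V i)] (hO : O.IsSignMonotone)
    {S : ∀ i, Finset (V i)} {s t : ∀ i, V i} (hs : O.IsSource S s) (ht : O.IsSink S t)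
    {a b c : ι} (hab : a ≠ b) (hac : a ≠ c) (hbc : b ≠ c)
    (hD : ∀ l, s l ≠ t l ↔ l = a ∨ l = b ∨ l = c)
    (h1 : O.arc (Function.update s a (t a)) (Function.update t b (s b)))
    (h2 : O.arc (Function.update s b (t b)) (Function.update t c (s c)))
    (h3 : O.arc (Function.update s c (t c)) (Function.update t a (s a))) :
    O.HasCubePaths S s t := by
  -- The last clause provides a coordinate l in which s+j agrees with s and t-π(i) with t, so these
  -- inner vertices are distinct.
  obtain ⟨π, hπ⟩ : ∃ π : ι → ι, ∀ i, s i ≠ t i → s (π i) ≠ t (π i) ∧ π i ≠ i ∧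
      O.arc (Function.update s i (t i)) (Function.update t (π i) (s (π i))) ∧
      (∀ j, s j ≠ t j → π i = π j → i = j) ∧
      ∀ j, ∃ l, s l ≠ t l ∧ l ≠ j ∧ l ≠ π i := by
    obtain ⟨π, ha', hb', hc'⟩ : ∃ π : ι → ι, π a = b ∧ π b = c ∧ π c = a :=
      ⟨fun l => if l = a then b else if l = b then c else a, by simp, by simp [hab.symm],
        by simp [hac.symm, hbc.symm]⟩
    have ha := (hD a).2 (by simp)
    have hb := (hD b).2 (by simp)
    have hc := (hD c).2 (by simp)
    refine ⟨π, fun i hi => ?_⟩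
    obtain rfl | rfl | rfl := (hD i).1 hi
    · refine ⟨by grind, by grind, ha' ▸ h1, by grind, fun j => ?_⟩
      by_cases hj : j = i
      · exact ⟨c, by grind⟩
      · exact ⟨i, by grind⟩
    · refine ⟨by grind, by grind, hb' ▸ h2, by grind, fun j => ?_⟩
      by_cases hj : j = i
      · exact ⟨a, by grind⟩
      · exact ⟨i, by grind⟩
    · refine ⟨by grind, by grind, hc' ▸ h3, by grind, fun j => ?_⟩
      by_cases hj : j = i
      · exact ⟨b, by grind⟩
      · exact ⟨i, by grind⟩
  clear hD h1 h2 h3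
  refine ⟨fun i => [Function.update t (π i) (s (π i)), t], fun i hi => ?_, fun i hi => ?_,
    fun i j hi hj hij => ?_⟩
  · obtain ⟨p1, p2, p3, -⟩ := hπ i hi
    have hchain : List.IsChain O.arc
        [s, Function.update s i (t i), Function.update t (π i) (s (π i)), t] := by
      simp [hs.arc_update (ht.1 i) hi, p3, ht.arc_update (hs.1 _) p1.symm]
    refine ⟨by simp, by simp, hchain, hO.nodup hchain, ?_⟩
    simp [hs.1, ht.1, InSubgrid.update hs.1 (ht.1 i), InSubgrid.update ht.1 (hs.1 (π i))]
  · simp only [List.mem_cons, List.not_mem_nil, or_false]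
    rintro v (rfl | rfl | rfl | rfl) l <;> grind [Function.update]
  · have hne : ∀ i j, s i ≠ t i → s j ≠ t j →
        Function.update s i (t i) ≠ Function.update t (π j) (s (π j)) := by
      intro i j hi hj h
      obtain ⟨l, h1, h2, h3⟩ := (hπ j hj).2.2.2.2 i
      have := congrFun h l
      simp [h2, h3] at this
      exact h1 this
    have hne1 : Function.update s i (t i) ≠ Function.update s j (t j) := by
      intro h
      have := congrFun h i
      simp [hij] at this
      exact hi this.symm
    have hne2 : Function.update t (π i) (s (π i)) ≠ Function.update t (π j) (s (π j)) := by
      intro h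
      have := congrFun h (π i)
      rw [Function.update_self, Function.update_of_ne] at this
      · exact (hπ i hi).1 this
      · exact fun h => hij ((hπ i hi).2.2.2.1 j hj h)
    have hne3 := hne i j hi hj
    have hne4 := hne j i hj hi
    simp only [List.mem_cons, List.not_mem_nil, or_false]
    clear hne hπ
    rintro v (h | h | h | h) (h' | h' | h' | h') <;> grind

theorem IsSignMonotone.exists_cube_paths [∀ i, Fintype (V i)] (hO : O.IsSignMonotone)
    {S : ∀ i, Finset (V i)} {s t : ∀ i, V i} (hs : O.IsSource S s) (ht : O.IsSink S t)
    (hD : (Finset.univ.filter fun i => s i ≠ t i).card ≤ 3) : O.HasCubePaths S s t := by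
  set D := Finset.univ.filter fun i => s i ≠ t i with hDdef
  have hmem : ∀ l, s l ≠ t l ↔ l ∈ D := by simp [D]
  obtain h | h | h | h : D.card = 0 ∨ D.card = 1 ∨ D.card = 2 ∨ D.card = 3 := by omega
  · have hn : ∀ l, ¬ s l ≠ t l := fun l hl => by
      rw [Finset.card_eq_zero] at h
      simpa [h] using (hmem l).1 hl
    exact ⟨fun _ => [], fun i hi => (hn i hi).elim, fun i hi => (hn i hi).elim,
      fun i _ hi => (hn i hi).elim⟩
  · obtain ⟨i, hi⟩ := Finset.card_eq_one.1 h
    simp only [hi, Finset.mem_singleton] at hmem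
    have hit := (hmem i).2 rfl
    have ht' : Function.update s i (t i) = t := by
      funext l
      have := hmem l
      grind [Function.update]
    have harc := hs.arc_update (ht.1 i) hit
    rw [ht'] at harc
    refine ⟨fun _ => [], fun l hl => ?_, fun l hl => ?_, fun l l' hl hl' hll => ?_⟩
    · obtain rfl := (hmem l).1 hl
      rw [ht']
      have hchain : List.IsChain O.arc [s, t] := by simp [harc]
      exact ⟨by simp, by simp, hchain, hO.nodup hchain, by simp [hs.1, ht.1]⟩
    · obtain rfl := (hmem l).1 hl
      rw [ht']
      simp only [List.mem_cons, List.not_mem_nil, or_false]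
      rintro v (rfl | rfl) <;> simp
    · exact (hll (((hmem l).1 hl).trans ((hmem l').1 hl').symm)).elim
  · obtain ⟨i, j, hij, hi⟩ := Finset.card_eq_two.1 h
    simp only [hi, Finset.mem_insert, Finset.mem_singleton] at hmem
    have harc : ∀ l, s l ≠ t l → O.arc (Function.update s l (t l)) t := by
      intro l hl
      obtain ⟨l', hl'⟩ : ∃ l', DifferOnlyAt l' (Function.update s l (t l)) t := by
        rcases (hmem l).1 hl with rfl | rfl
        · refine ⟨j, ?_, fun l hl => ?_⟩ <;> grind [Function.update]
        · refine ⟨i, ?_, fun l hl => ?_⟩ <;> grind [Function.update]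
      exact ht.2 _ (InSubgrid.update hs.1 (ht.1 l)) hl'.symm.adj
    refine ⟨fun _ => [t], fun l hl => ?_, fun l hl => ?_, fun l l' hl hl' hll => ?_⟩
    · have hchain : List.IsChain O.arc [s, Function.update s l (t l), t] := by
        simp [hs.arc_update (ht.1 l) hl, harc l hl]
      exact ⟨by simp, by simp, hchain, hO.nodup hchain,
        by simp [hs.1, ht.1, InSubgrid.update hs.1 (ht.1 l)]⟩
    · simp only [List.mem_cons, List.not_mem_nil, or_false]
      rintro v (rfl | rfl | rfl) l <;> grind [Function.update]
    · have hne : Function.update s l (t l) ≠ Function.update s l' (t l') := by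
        intro h
        have := congrFun h l
        simp [hll] at this
        exact hl this.symm
      simp only [List.mem_cons, List.not_mem_nil, or_false]
      clear harc hmem
      rintro v (h | h | h) (h' | h' | h') <;> grind
  · obtain ⟨a, b, c, hab, hbc, hi⟩ := exists_lt_lt_of_card_eq_three h
    simp only [hi, Finset.mem_insert, Finset.mem_singleton] at hmem
    have hac := hab.trans hbc
    have ha := (hmem a).2 (by simp)
    have hb := (hmem b).2 (by simp)
    have hc := (hmem c).2 (by simp)
    have hst : ∀ l, l ≠ a → l ≠ b → l ≠ c → s l = t l := by grind
    -- Only the arc of the middle dimension b constrains the cyclic order: a → b → c → a needs s b <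
    -- t b, and otherwise the reverse cycle works.
    by_cases hm : s b < t b
    · refine hO.hasCubePaths_of_cycle hs ht hab.ne hac.ne hbc.ne hmem ?_ ?_ ?_
      · refine hO.arc_update_update hs ht hac.ne' hbc.ne' hab.ne hc ha hb (by grind) ?_
        grind
      · refine hO.arc_update_update hs ht hab.ne hac.ne hbc.ne ha hb hc (by grind) ?_
        grind
      · refine hO.arc_update_update hs ht hbc.ne hab.ne' hac.ne' hb hc ha (by grind) ?_
        grind
    · refine hO.hasCubePaths_of_cycle hs ht hac.ne hab.ne hbc.ne' (by grind) ?_ ?_ ?_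
      · refine hO.arc_update_update hs ht hab.ne' hbc.ne hac.ne hb ha hc (by grind) ?_
        grind
      · refine hO.arc_update_update hs ht hac.ne hab.ne hbc.ne' ha hc hb (by grind) ?_
        grind
      · refine hO.arc_update_update hs ht hbc.ne' hac.ne' hab.ne' hc hb ha (by grind) ?_
        grind

/-- Paths are indexed by the out-neighbours (i, x) of s, which gives the right count. An inner
vertex of a slab path has a coordinate that is neither that of s nor that of t, and this coordinate
identifies (i, x). -/
theorem IsSignMonotone.hasDisjointDipaths [∀ i, Fintype (V i)] (hO : O.IsSignMonotone)
    (hdim : gridDim V ≤ 3) {S : ∀ i, Finset (V i)} {s t : ∀ i, V i} (hs : O.IsSource S s)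
    (ht : O.IsSink S t) :
    O.HasDisjointDipaths S ((∑ i, (S i).card) - Fintype.card ι) s t := by
  have hle : ∀ D : Finset ι, (∀ i ∈ D, ∃ x y : V i, x ≠ y) → D.card ≤ 3 := fun D hD =>
    (Finset.card_le_card fun i hi => Finset.mem_filter.2
      ⟨Finset.mem_univ _, Fintype.one_lt_card_iff.2 (hD i hi)⟩).trans hdim
  obtain ⟨R, hR1, hR2, hR3⟩ := hO.exists_cube_paths hs ht
    (hle _ fun i hi => ⟨s i, t i, by simpa using hi⟩)
  have hslab : ∀ i x, x ∈ S i → s i ≠ x → t i ≠ x →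
      ∃ q, O.IsDipath S s t (s :: Function.update s i x :: q) ∧
        ∀ v ∈ s :: Function.update s i x :: q,
          v = s ∨ v = t ∨ v i = x ∧ ∀ l, l ≠ i → v l = s l ∨ v l = t l := by
    intro i x hx hxs hxt
    refine hO.exists_slab_path hs ht hx hxs hxt ?_
    -- Dimension i is nontrivial because s i ≠ x, which leaves at most two others.
    have h := hle (insert i (Finset.univ.filter fun l => l ≠ i ∧ s l ≠ t l)) ?_
    · rw [Finset.card_insert_of_notMem (by simp)] at h
      omega
    · intro l hl
      rcases Finset.mem_insert.1 hl with rfl | hl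
      · exact ⟨s l, x, hxs⟩
      · exact ⟨s l, t l, (Finset.mem_filter.1 hl).2.2⟩
  choose! Q hQ1 hQ2 using hslab
  let K := Σ i, {x // x ∈ (S i).erase (s i)}
  have hcard : Fintype.card K = (∑ i, (S i).card) - Fintype.card ι := by
    have h1 : ∀ i, ((S i).erase (s i)).card + 1 = (S i).card :=
      fun i => Finset.card_erase_add_one (hs.1 i)
    simp only [K, Fintype.card_sigma, Fintype.card_coe]
    rw [← Finset.sum_congr rfl fun i _ => h1 i, Finset.sum_add_distrib]
    simp
  let e : Fin ((∑ i, (S i).card) - Fintype.card ι) ≃ K :=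
    (Fintype.equivFinOfCardEq hcard).symm
  let rest : K → List (∀ i, V i) := fun k => if k.2.1 = t k.1 then R k.1 else Q k.1 k.2.1
  let P : K → List (∀ i, V i) := fun k => s :: Function.update s k.1 k.2.1 :: rest k
  have hcube : ∀ k : K, k.2.1 = t k.1 → s k.1 ≠ t k.1 ∧
      P k = s :: Function.update s k.1 (t k.1) :: R k.1 := by
    rintro ⟨i, x, hx⟩ h
    change x = t i at h
    subst h
    exact ⟨(Finset.mem_erase.1 hx).1.symm, by simp [P, rest]⟩
  have hslab : ∀ k : K, k.2.1 ≠ t k.1 → k.2.1 ∈ S k.1 ∧ s k.1 ≠ k.2.1 ∧ t k.1 ≠ k.2.1 ∧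
      P k = s :: Function.update s k.1 k.2.1 :: Q k.1 k.2.1 := by
    rintro ⟨i, x, hx⟩ h
    exact ⟨(Finset.mem_erase.1 hx).2, (Finset.mem_erase.1 hx).1.symm, h.symm,
      by simp only [P, rest, if_neg h]⟩
  have hP : ∀ k, O.IsDipath S s t (P k) := by
    intro k
    by_cases hk : k.2.1 = t k.1
    · rw [(hcube k hk).2]
      exact hR1 _ (hcube k hk).1
    · obtain ⟨h1, h2, h3, h4⟩ := hslab k hk
      rw [h4]
      exact hQ1 _ _ h1 h2 h3
  have hPc : ∀ k : K, k.2.1 = t k.1 → ∀ v ∈ P k, ∀ l, v l = s l ∨ v l = t l := by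
    intro k hk
    rw [(hcube k hk).2]
    exact hR2 _ (hcube k hk).1
  have hPs : ∀ k : K, k.2.1 ≠ t k.1 → ∀ v ∈ P k,
      v = s ∨ v = t ∨ v k.1 = k.2.1 ∧ ∀ l, l ≠ k.1 → v l = s l ∨ v l = t l := by
    intro k hk
    obtain ⟨h1, h2, h3, h4⟩ := hslab k hk
    rw [h4]
    exact hQ2 _ _ h1 h2 h3
  have hPinj : Function.Injective P := by
    rintro ⟨i, x, hx⟩ ⟨j, y, hy⟩ h
    have h' : Function.update s i x = Function.update s j y := (List.cons.inj (List.cons.inj h).2).1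
    have hi := congrFun h' i
    have hxs := (Finset.mem_erase.1 hx).1
    by_cases hij : i = j
    · subst hij
      simp at hi
      subst hi
      rfl
    · simp [hij] at hi
      exact (hxs hi).elim
  have hdisj : ∀ k k' : K, k ≠ k' → k.2.1 ≠ t k.1 → ∀ v ∈ P k, v ∈ P k' → v = s ∨ v = t := by
    intro k k' hne hk v hv hv'
    obtain h | h | ⟨h1, h2⟩ := hPs k hk v hv
    · exact Or.inl h
    · exact Or.inr h
    obtain ⟨-, hks, -, -⟩ := hslab k hk
    by_cases hk' : k'.2.1 = t k'.1
    · rcases hPc k' hk' v hv' k.1 with h | h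
      · exact (hks (h.symm.trans h1)).elim
      · exact (hk (h1.symm.trans h)).elim
    · obtain h | h | ⟨h3, h4⟩ := hPs k' hk' v hv'
      · exact Or.inl h
      · exact Or.inr h
      by_cases hkk : k.1 = k'.1
      · obtain ⟨i, x, hx⟩ := k
        obtain ⟨j, y, hy⟩ := k'
        dsimp only at hkk h1 h3
        subst hkk
        subst h1
        subst h3
        exact (hne rfl).elim
      · rcases h4 k.1 hkk with h | h
        · exact (hks (h.symm.trans h1)).elim
        · exact (hk (h1.symm.trans h)).elim
  refine ⟨fun a => P (e a), hPinj.comp e.injective, fun a => hP _, fun a b hab v hva hvb => ?_⟩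
  have hne : e a ≠ e b := fun h => hab (e.injective h)
  by_cases ha : (e a).2.1 = t (e a).1
  · by_cases hb : (e b).2.1 = t (e b).1
    · have hij : (e a).1 ≠ (e b).1 := by
        intro h
        generalize e a = k at *
        generalize e b = k' at *
        obtain ⟨i, x, hx⟩ := k
        obtain ⟨j, y, hy⟩ := k'
        dsimp only at h ha hb
        subst h
        subst ha
        subst hb
        exact hne rfl
      obtain ⟨h1, h2⟩ := hcube _ ha
      obtain ⟨h3, h4⟩ := hcube _ hb
      exact hR3 _ _ h1 h3 hij v (h2 ▸ hva) (h4 ▸ hvb)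
    · exact hdisj _ _ hne.symm hb v hvb hva
  · exact hdisj _ _ hne ha v hva hvb

/-- Sign-monotone orientations of grids of dimension at most 3 are admissible. -/
theorem IsSignMonotone.isAdmissible [∀ i, Fintype (V i)] (hO : O.IsSignMonotone)
    (hdim : gridDim V ≤ 3) : O.IsAdmissible := by
  have hle : ∀ u v : ∀ i, V i, (Finset.univ.filter fun i => u i ≠ v i).card ≤ 3 := fun u v =>
    (Finset.card_le_card fun i hi => Finset.mem_filter.2
      ⟨Finset.mem_univ _, Fintype.one_lt_card_iff.2 ⟨u i, v i, by simpa using hi⟩⟩).trans hdim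
  refine ⟨fun S hS => ?_, fun S hS => ?_⟩
  · obtain ⟨t, ht⟩ := hO.exists_isSink S hS
    exact ⟨t, ht, fun t' ht' => hO.isSink_unique ht' ht (hle _ _)⟩
  · obtain ⟨t, ht⟩ := hO.exists_isSink S hS
    obtain ⟨s, hs⟩ := hO.reverse.exists_isSink S hS
    rw [isSink_reverse] at hs
    exact ⟨s, t, ⟨hs, fun s' hs' => hO.reverse.isSink_unique hs' hs (hle _ _)⟩,
      ⟨ht, fun t' ht' => hO.isSink_unique ht' ht (hle _ _)⟩, hO.hasDisjointDipaths hdim hs ht⟩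

end Orientation

end Grid

end GridUSO

/-! ### From signotopes to sign-monotone orientations -/

namespace GridUSO

theorem exists_castSucc_ne_succ {R : ℕ} (f : Fin (R + 1) → Bool) {i j : Fin (R + 1)}
    (hij : i ≤ j) (h : f i ≠ f j) :
    ∃ m : Fin R, i ≤ m.castSucc ∧ m.succ ≤ j ∧ f m.castSucc ≠ f m.succ := by
  by_contra hn
  push Not at hn
  have key : ∀ k : Fin (R + 1), i ≤ k → k ≤ j → f k = f i := by
    intro k
    induction k using Fin.induction with
    | zero =>
      intro hi _
      rw [Fin.le_zero_iff.1 hi]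
    | succ m ih =>
      intro hi hj
      by_cases him : i ≤ m.castSucc
      · rw [← hn m him hj]
        exact ih him (m.castSucc_lt_succ.le.trans hj)
      · rw [le_antisymm hi (Fin.castSucc_lt_iff_succ_le.1 (not_le.1 him))]
  exact h (key j hij le_rfl).symm

/-- The value of a sign map at a set, with a default value at sets of the wrong size. -/
def SignMap.val {n R : ℕ} (χ : SignMap n R) (A : Finset (Fin n)) : Bool :=
  if h : A.card = R then χ ⟨A, h⟩ else false

/-- A deviating middle sign would force one sign change on each side of it. -/
theorem IsSignotope.val_erase_eq {n R : ℕ} {χ : SignMap n R} (hχ : IsSignotope χ)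
    {A : Finset (Fin n)} (hA : A.card = R + 1) {x y z : Fin n} (hx : x ∈ A) (hy : y ∈ A)
    (hz : z ∈ A) (hxy : x < y) (hyz : y < z) (h : χ.val (A.erase x) = χ.val (A.erase z)) :
    χ.val (A.erase y) = χ.val (A.erase x) := by
  have hval : ∀ i, χ.val (A.erase (A.orderEmbOfFin hA i)) = signSeq χ ⟨A, hA⟩ i := by
    intro i
    have : (A.erase (A.orderEmbOfFin hA i)).card = R := by
      rw [Finset.card_erase_of_mem (Finset.orderEmbOfFin_mem _ _ _), hA]; rfl
    simp [SignMap.val, signSeq, this]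
  have hex : ∀ w ∈ A, ∃ i, A.orderEmbOfFin hA i = w := by
    intro w hw
    rwa [← Finset.mem_coe, ← Finset.range_orderEmbOfFin A hA] at hw
  obtain ⟨i, rfl⟩ := hex x hx
  obtain ⟨j, rfl⟩ := hex y hy
  obtain ⟨k, rfl⟩ := hex z hz
  rw [hval, hval] at h ⊢
  rw [OrderEmbedding.lt_iff_lt] at hxy hyz
  by_contra hne
  obtain ⟨m, -, hm1, hm2⟩ := exists_castSucc_ne_succ _ hxy.le (Ne.symm hne)
  obtain ⟨m', hm1', -, hm2'⟩ := exists_castSucc_ne_succ _ hyz.le (h ▸ hne)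
  have hmm : m ≠ m' := by
    rintro rfl
    exact absurd (hm1.trans hm1') (not_le.2 m.castSucc_lt_succ)
  refine absurd (hχ ⟨A, hA⟩) (not_le.2 (Finset.one_lt_card.2 ⟨m, ?_, m', ?_, hmm⟩))
  · simpa using hm2
  · simpa using hm2'

section Induced

variable {n r : ℕ} {C : Fin r → Finset (Fin n)}

theorem IsBlockPartition.mem_coordSet (hC : IsBlockPartition C) {z : Fin n} {j : Fin r}
    (hz : z ∈ C j) (u : ∀ i, C i) : z ∈ coordSet u ↔ (u j : Fin n) = z := by
  simp only [coordSet, Finset.mem_image, Finset.mem_univ, true_and]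
  refine ⟨?_, fun h => ⟨j, h⟩⟩
  rintro ⟨i, rfl⟩
  obtain rfl := hC.eq_of_mem (u i).2 hz
  rfl

theorem coord_mem_coordSet (u : ∀ i, C i) (i : Fin r) : (u i : Fin n) ∈ coordSet u :=
  Finset.mem_image_of_mem _ (Finset.mem_univ i)

theorem inducedOrientation_arc_iff (χ : SignMap n (r + 1)) (hC : IsBlockPartition C) {i : Fin r}
    {u v : ∀ i, C i} (h : DifferOnlyAt i u v) :
    (inducedOrientation χ hC).arc u v ↔
      (u i < v i ↔ χ.val (coordSet u ∪ coordSet v) = true) := by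
  have hval : χ.val (coordSet u ∪ coordSet v) =
      χ ⟨coordSet u ∪ coordSet v, card_coordSet_union hC i u v h⟩ := by
    simp [SignMap.val, card_coordSet_union hC i u v h]
  have harc : (inducedOrientation χ hC).arc u v ↔
      (u i < v i ∧ χ.val (coordSet u ∪ coordSet v) = true) ∨
        (v i < u i ∧ χ.val (coordSet u ∪ coordSet v) = false) := by
    rw [hval]
    constructor
    · rintro ⟨j, hj, hh⟩
      obtain rfl : j = i := by
        by_contra hne
        exact hj.1 (h.2 j hne)
      exact hh
    · exact fun hh => ⟨i, h, hh⟩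
  rw [harc]
  rcases lt_or_gt_of_ne h.1 with hlt | hlt
  · simp [hlt, hlt.not_gt]
  · simp [hlt, hlt.not_gt]

/-- Orientations induced by signotopes are sign-monotone. -/
theorem IsSignotope.isSignMonotone {χ : SignMap n (r + 1)} (hχ : IsSignotope χ)
    (hC : IsBlockPartition C) : (inducedOrientation χ hC).IsSignMonotone where
  line := by
    intro p a b c hab hbc hac h1 h2
    rw [inducedOrientation_arc_iff χ hC hab] at h1
    rw [inducedOrientation_arc_iff χ hC hbc] at h2
    rw [inducedOrientation_arc_iff χ hC hac]
    set A := coordSet a ∪ coordSet b ∪ coordSet c with hA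
    have ea : A.erase (a p) = coordSet b ∪ coordSet c := by
      ext z
      obtain ⟨j, hj⟩ := hC.cover z
      simp only [hA, Finset.mem_erase, Finset.mem_union, hC.mem_coordSet hj]
      have hjp : z = a p → j = p := fun h => hC.eq_of_mem hj (h ▸ (a p).2)
      have := hab.1
      have := hab.2 j
      have := hac.1
      grind
    have eb : A.erase (b p) = coordSet a ∪ coordSet c := by
      ext z
      obtain ⟨j, hj⟩ := hC.cover z
      simp only [hA, Finset.mem_erase, Finset.mem_union, hC.mem_coordSet hj]
      have hjp : z = b p → j = p := fun h => hC.eq_of_mem hj (h ▸ (b p).2)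
      have := hab.1
      have := hab.2 j
      have := hbc.1
      grind
    have ec : A.erase (c p) = coordSet a ∪ coordSet b := by
      ext z
      obtain ⟨j, hj⟩ := hC.cover z
      simp only [hA, Finset.mem_erase, Finset.mem_union, hC.mem_coordSet hj]
      have hjp : z = c p → j = p := fun h => hC.eq_of_mem hj (h ▸ (c p).2)
      have := hac.1
      have := hac.2 j
      have := hbc.1
      grind
    have ha : (a p : Fin n) ∈ A := by simp [hA, coord_mem_coordSet]
    have hb : (b p : Fin n) ∈ A := by simp [hA, coord_mem_coordSet]
    have hc : (c p : Fin n) ∈ A := by simp [hA, coord_mem_coordSet]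
    have hcard : A.card = r + 1 + 1 := by
      rw [← Finset.card_erase_add_one hc, ec, card_coordSet_union hC p a b hab]
    -- One instance for each possible order of the three entries in coordinate p.
    have k1 := hχ.val_erase_eq hcard ha hb hc
    have k2 := hχ.val_erase_eq hcard ha hc hb
    have k3 := hχ.val_erase_eq hcard hb ha hc
    have k4 := hχ.val_erase_eq hcard hb hc ha
    have k5 := hχ.val_erase_eq hcard hc ha hb
    have k6 := hχ.val_erase_eq hcard hc hb ha
    rw [ea, eb, ec] at k1 k2 k3 k4 k5 k6
    have n1 := Subtype.coe_injective.ne hab.1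
    have n2 := Subtype.coe_injective.ne hbc.1
    have n3 := Subtype.coe_injective.ne hac.1
    rw [← Subtype.coe_lt_coe] at h1 h2 ⊢
    clear ea eb ec ha hb hc hcard hab hbc hac
    grind
  square := by
    intro p q a b a' b' hpq hab hab' ha hb hm h1 h2
    rw [inducedOrientation_arc_iff χ hC hab] at h1
    rw [inducedOrientation_arc_iff χ hC ha, inducedOrientation_arc_iff χ hC hb] at h2
    rw [inducedOrientation_arc_iff χ hC hab']
    have e1 : a' p = a p := (ha.2 p hpq).symm
    have e2 : b' p = b p := (hb.2 p hpq).symm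
    have e3 : b q = a q := (hab.2 q hpq.symm).symm
    have e4 : b' q = a' q := (hab'.2 q hpq.symm).symm
    set A := coordSet a ∪ coordSet b ∪ coordSet a' ∪ coordSet b' with hA
    have eq1 : A.erase (a p) = coordSet b ∪ coordSet b' := by
      ext z
      obtain ⟨j, hj⟩ := hC.cover z
      simp only [hA, Finset.mem_erase, Finset.mem_union, hC.mem_coordSet hj]
      have hjp : z = a p → j = p := fun h => hC.eq_of_mem hj (h ▸ (a p).2)
      have := hab.1
      have := hab.2 j
      have := hab'.2 j
      grind
    have eq2 : A.erase (b p) = coordSet a ∪ coordSet a' := by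
      ext z
      obtain ⟨j, hj⟩ := hC.cover z
      simp only [hA, Finset.mem_erase, Finset.mem_union, hC.mem_coordSet hj]
      have hjp : z = b p → j = p := fun h => hC.eq_of_mem hj (h ▸ (b p).2)
      have := hab.1
      have := hab.2 j
      have := hab'.2 j
      grind
    have eq3 : A.erase (a q) = coordSet a' ∪ coordSet b' := by
      ext z
      obtain ⟨j, hj⟩ := hC.cover z
      simp only [hA, Finset.mem_erase, Finset.mem_union, hC.mem_coordSet hj]
      have hjp : z = a q → j = q := fun h => hC.eq_of_mem hj (h ▸ (a q).2)
      have := ha.1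
      have := ha.2 j
      have := hb.2 j
      grind
    have eq4 : A.erase (a' q) = coordSet a ∪ coordSet b := by
      ext z
      obtain ⟨j, hj⟩ := hC.cover z
      simp only [hA, Finset.mem_erase, Finset.mem_union, hC.mem_coordSet hj]
      have hjp : z = a' q → j = q := fun h => hC.eq_of_mem hj (h ▸ (a' q).2)
      have := ha.1
      have := ha.2 j
      have := hb.2 j
      grind
    have m1 : (a p : Fin n) ∈ A := by simp [hA, coord_mem_coordSet]
    have m2 : (b p : Fin n) ∈ A := by simp [hA, coord_mem_coordSet]
    have m3 : (a q : Fin n) ∈ A := by simp [hA, coord_mem_coordSet]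
    have m4 : (a' q : Fin n) ∈ A := by simp [hA, coord_mem_coordSet]
    have hcard : A.card = r + 1 + 1 := by
      rw [← Finset.card_erase_add_one m4, eq4, card_coordSet_union hC p a b hab]
    have n1 := hab.1
    have n2 := ha.1
    rw [e1, e2]
    rw [e3, e4] at h2
    -- The block order puts both p-entries on the same side of both q-entries. Deleting a q-entry
    -- leaves a p-edge and vice versa, so the two p-edge signs are adjacent in each triple and the
    -- q-edge sign is at its end.
    rcases lt_or_gt_of_ne hpq with hlt | hlt
    · have l1 := hC.lt p q hlt
      have k1 := hχ.val_erase_eq hcard m1 m3 m4 (l1 _ (a p).2 _ (a q).2)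
      have k2 := hχ.val_erase_eq hcard m2 m3 m4 (l1 _ (b p).2 _ (a q).2)
      have k3 := hχ.val_erase_eq hcard m1 m4 m3 (l1 _ (a p).2 _ (a' q).2)
      have k4 := hχ.val_erase_eq hcard m2 m4 m3 (l1 _ (b p).2 _ (a' q).2)
      rw [eq1, eq3, eq4] at k1 k3
      rw [eq2, eq3, eq4] at k2 k4
      simp only [Subtype.coe_lt_coe] at k1 k2 k3 k4
      generalize χ.val (coordSet a ∪ coordSet b) = sab at *
      generalize χ.val (coordSet a' ∪ coordSet b') = sab' at *
      generalize χ.val (coordSet a ∪ coordSet a') = sa at *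
      generalize χ.val (coordSet b ∪ coordSet b') = sb at *
      clear l1
      grind
    · have l1 := hC.lt q p hlt
      have k1 := fun h => hχ.val_erase_eq hcard m3 m4 m1 h (l1 _ (a' q).2 _ (a p).2)
      have k2 := fun h => hχ.val_erase_eq hcard m3 m4 m2 h (l1 _ (a' q).2 _ (b p).2)
      have k3 := fun h => hχ.val_erase_eq hcard m4 m3 m1 h (l1 _ (a q).2 _ (a p).2)
      have k4 := fun h => hχ.val_erase_eq hcard m4 m3 m2 h (l1 _ (a q).2 _ (b p).2)
      rw [eq1, eq3, eq4] at k1 k3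
      rw [eq2, eq3, eq4] at k2 k4
      simp only [Subtype.coe_lt_coe] at k1 k2 k3 k4
      have := hlt.not_gt
      generalize χ.val (coordSet a ∪ coordSet b) = sab at *
      generalize χ.val (coordSet a' ∪ coordSet b') = sab' at *
      generalize χ.val (coordSet a ∪ coordSet a') = sa at *
      generalize χ.val (coordSet b ∪ coordSet b') = sb at *
      clear l1
      grind

end Induced

end GridUSO

theorem mainTheorem3 {n r : ℕ} (χ : GridUSO.SignMap n (r + 1)) (hχ : GridUSO.IsSignotope χ)
    (C : Fin r → Finset (Fin n)) (hC : GridUSO.IsBlockPartition C)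
    (hdim : GridUSO.gridDim (fun i => C i) ≤ 3) :
    (GridUSO.inducedOrientation χ hC).IsAdmissible :=
  (hχ.isSignMonotone hC).isAdmissible hdim
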